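/- Let $k\ge 1$ be an integer, let $W_k=\{(x_1,\dots,x_k)\in\mathbb Z^k : x_1>x_2>\dots>x_k>0\}$, let $e_1,\dots,e_k$ be the standard unit vectors and let $\delta=(k,k-1,\dots,1)$. An oscillating walk of length $n$ in $W_k$ is a walk with $n$ steps, each of them one of $\pm e_1,\dots,\pm e_k$, all of whose points lie in $W_k$. Let $$O_k(t)=\sum_{n\ge 0} o_n\,t^n,$$ where $o_n$ is the number of oscillating walks of length $n$ in $W_k$ that start at $\delta$ and end at a point of $\{m e_1+\delta : m\ge 0\}$. For a formal power series $F=\sum f_{i_1,\dots,i_k,j}\,z_1^{i_1}\cdots z_k^{i_k}t^j$ let $\Delta F=\sum_{n\ge0} f_{n,\dots,n,n}\,t^n$ be its diagonal; the diagonal of a rational function is that of its power series expansion at the origin. Write $\overline z_i=1/z_i$. Then the rational function below has a power series expansion at the origin, and $$(-1)^{k(k-1)/2}\,t^{2k-1}\,O_k(t)=\Delta\left[\frac{t^{2k-1}\,(z_3z_4^2\cdots z_k^{k-2})\,(z_1+1)\prod_{1\le j<i\le k}(z_i-z_j)(z_iz_j-1)\cdot\prod_{2\le i\le k}(z_i^2-1)}{1-t\,(z_1\cdots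 z_k)\,(z_1+\overline z_1+\cdots+z_k+\overline z_k)}\right].$$ -/

import Mathlib

/-! ### Oscillating walks in the Weyl chamber `x₁ > x₂ > ⋯ > x_k > 0`

Coordinates are indexed by `Fin k`, so the usual index `i ∈ {1, …, k}` is `i.val + 1`. -/

/-- The region `W_k = {(x₁, …, x_k) ∈ ℤ^k : x₁ > x₂ > ⋯ > x_k > 0}`. -/
def weylChamber (k : ℕ) : Set (Fin k → ℤ) :=
  {x | StrictAnti x ∧ ∀ i, 0 < x i}

/-- The starting point `δ = (k, k - 1, …, 1)`. -/
def deltaPoint (k : ℕ) : Fin k → ℤ := fun i => (k : ℤ) - (i.val : ℤ)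

/-- The step `e_i` (encoded by `(i, true)`) or `-e_i` (encoded by `(i, false)`). -/
def oscStep {k : ℕ} (s : Fin k × Bool) : Fin k → ℤ :=
  Pi.single s.1 (if s.2 then 1 else -1)

/-- The point reached after the first `j` steps of a walk that starts at `δ` and has the
step sequence `w`. -/
def oscPosition {k n : ℕ} (w : Fin n → Fin k × Bool) (j : ℕ) : Fin k → ℤ :=
  deltaPoint k + ∑ i : Fin n with i.val < j, oscStep (w i)

/-- The oscillating walks of length `n` in `W_k` (given by their step sequences) that start
at `δ` and end at a point of `{m e₁ + δ : m ≥ 0}`. -/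
def oscWalks (k : ℕ) [NeZero k] (n : ℕ) : Set (Fin n → Fin k × Bool) :=
  {w | (∀ j ≤ n, oscPosition w j ∈ weylChamber k) ∧
    ∃ m : ℕ, oscPosition w n = Pi.single (0 : Fin k) (m : ℤ) + deltaPoint k}

/-- The ordinary generating function `O_k(t)` of these walks, by length. -/
noncomputable def oscGF (k : ℕ) [NeZero k] : PowerSeries ℚ :=
  PowerSeries.mk fun n => ((oscWalks k n).ncard : ℚ)

/-! ### Diagonals of rational functions

The variables `z₁, …, z_k, t` are indexed by `Option (Fin k)`: `some i` for the `z`'s and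
`none` for `t`. -/

/-- The field `ℚ(z₁, …, z_k, t)`. -/
abbrev RatFun (k : ℕ) : Type := FractionRing (MvPolynomial (Option (Fin k)) ℚ)

/-- `f` is the power series expansion at the origin of the rational function `R`: one can
write `R = p / q` with polynomials `p, q` such that `q(0) ≠ 0` and `q * f = p`. -/
def IsExpansion {k : ℕ} (R : RatFun k) (f : MvPowerSeries (Option (Fin k)) ℚ) : Prop :=
  ∃ p q : MvPolynomial (Option (Fin k)) ℚ, MvPolynomial.constantCoeff q ≠ 0 ∧
    R = algebraMap _ (RatFun k) p / algebraMap _ (RatFun k) q ∧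
    (q : MvPowerSeries (Option (Fin k)) ℚ) * f = (p : MvPowerSeries (Option (Fin k)) ℚ)

/-- A rational function has at most one expansion. -/
theorem IsExpansion.unique {k : ℕ} {R : RatFun k} {f g : MvPowerSeries (Option (Fin k)) ℚ}
    (hf : IsExpansion R f) (hg : IsExpansion R g) : f = g := by
  obtain ⟨p, q, hq, hR, h⟩ := hf
  obtain ⟨p', q', hq', hR', h'⟩ := hg
  have hq0 : q ≠ 0 := by rintro rfl; simp at hq
  have hq0' : q' ≠ 0 := by rintro rfl; simp at hq'
  have inj := IsFractionRing.injective (MvPolynomial (Option (Fin k)) ℚ) (RatFun k)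
  have e : p * q' = p' * q := by
    apply inj
    rw [map_mul, map_mul]
    rw [hR, div_eq_div_iff] at hR'
    · exact hR'
    · simpa using hq0
    · simpa using hq0'
  have e' : (p : MvPowerSeries (Option (Fin k)) ℚ) * q' = p' * q := by
    exact_mod_cast congrArg (fun r : MvPolynomial (Option (Fin k)) ℚ =>
      (r : MvPowerSeries (Option (Fin k)) ℚ)) e
  have n1 : (q : MvPowerSeries (Option (Fin k)) ℚ) ≠ 0 := by simpa using hq0
  have n2 : (q' : MvPowerSeries (Option (Fin k)) ℚ) ≠ 0 := by simpa using hq0'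
  apply mul_left_cancel₀ (mul_ne_zero n1 n2)
  linear_combination (q' : MvPowerSeries (Option (Fin k)) ℚ) * h -
    (q : MvPowerSeries (Option (Fin k)) ℚ) * h' + e'

/-- The (complete) diagonal operator: `Δ ∑ f_{i₁,…,i_k,j} z₁^{i₁} ⋯ z_k^{i_k} t^j` is
`∑ f_{n,…,n,n} t^n`. -/
noncomputable def diagonal {k : ℕ} (f : MvPowerSeries (Option (Fin k)) ℚ) : PowerSeries ℚ :=
  PowerSeries.mk fun n => MvPowerSeries.coeff (Finsupp.equivFunOnFinite.symm fun _ => n) f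

/-- `g = Δ R`: the rational function `R` has a power series expansion, with diagonal `g`. -/
def IsDiagonalOf {k : ℕ} (g : PowerSeries ℚ) (R : RatFun k) : Prop :=
  ∃ f, IsExpansion R f ∧ g = diagonal f

/-- The variable `z_{i+1}` as a rational function. -/
noncomputable def zVar {k : ℕ} (i : Fin k) : RatFun k :=
  algebraMap (MvPolynomial (Option (Fin k)) ℚ) (RatFun k) (MvPolynomial.X (some i))

/-- The variable `t` as a rational function. -/
noncomputable def tVar (k : ℕ) : RatFun k :=
  algebraMap (MvPolynomial (Option (Fin k)) ℚ) (RatFun k) (MvPolynomial.X none)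

/-- The rational function
`t^{2k-1} (z₃ z₄² ⋯ z_k^{k-2}) (z₁ + 1) ∏_{j<i} (z_i - z_j)(z_i z_j - 1) ∏_{i≥2} (z_i² - 1)`
divided by `1 - t (z₁ ⋯ z_k) (z₁ + z₁⁻¹ + ⋯ + z_k + z_k⁻¹)`. -/
noncomputable def oscRational (k : ℕ) [NeZero k] : RatFun k :=
  (tVar k ^ (2 * k - 1)
      * (∏ i : Fin k with 2 ≤ i.val, zVar i ^ (i.val - 1))
      * (zVar (0 : Fin k) + 1)
      * (∏ i : Fin k, ∏ j : Fin k with j < i, (zVar i - zVar j) * (zVar i * zVar j - 1))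
      * ∏ i : Fin k with 1 ≤ i.val, (zVar i ^ 2 - 1))
    / (1 - tVar k * (∏ i : Fin k, zVar i) * ∑ i : Fin k, (zVar i + (zVar i)⁻¹))

/-! This is the reflection principle of Gessel and Zeilberger in type C. Put `S = ∑ (z_i + z_i⁻¹)`
and let `D = ∏ (z_i - z_i⁻¹) · ∏_{j<i} ((z_i + z_i⁻¹) - (z_j + z_j⁻¹))`. The coefficients of `D S^n`
alternate under permutations and sign changes of coordinates, obey the walk recurrence and vanish on
the walls. In the chamber `D` has the single term `ε z^δ`, `ε = (-1)^{k(k-1)/2}`, so `[z^x] D S^n`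
is `ε` times the number of walks from `δ` to `x` (`coeff_weylDenom_mul_stepSum_pow`).

Write `D = (z₁ - z₁⁻¹) E`. Summing over the end points `δ + m e₁` multiplies by `1 / (1 - z₁⁻¹)`,
and `(z₁ - z₁⁻¹) / (1 - z₁⁻¹) = z₁ + 1`, so the total is `[z^δ] (z₁ + 1) E S^n`
(`sum_range_coeff_sub_mul`). Clearing negative exponents turns `S` into `Q = z₁⋯z_k S` and `(z₁ + 1)
E` into the stated numerator `P`; the total becomes the coefficient of `(z₁⋯z_k)^{n+2k-1}` in `P
Q^n`, a diagonal coefficient of `t^{2k-1} P / (1 - t Q)`. -/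

/-! ### Counting walks in the chamber by an alternating function -/

/-- The walks of length `n` in `W_k` that start at `δ` and end at `x`. -/
def oscWalksTo (k n : ℕ) (x : Fin k → ℤ) : Set (Fin n → Fin k × Bool) :=
  {w | (∀ j ≤ n, oscPosition w j ∈ weylChamber k) ∧ oscPosition w n = x}

theorem oscPosition_snoc_of_le {k n : ℕ} (w : Fin n → Fin k × Bool) (s : Fin k × Bool) {j : ℕ}
    (hj : j ≤ n) :
    oscPosition (Fin.snoc w s : Fin (n + 1) → Fin k × Bool) j = oscPosition w j := by
  unfold oscPosition
  simp [Finset.sum_filter, Fin.sum_univ_castSucc, hj.not_gt]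

theorem oscPosition_snoc_last {k n : ℕ} (w : Fin n → Fin k × Bool) (s : Fin k × Bool) :
    oscPosition (Fin.snoc w s : Fin (n + 1) → Fin k × Bool) (n + 1) =
      oscPosition w n + oscStep s := by
  unfold oscPosition
  simp [Finset.sum_filter, Fin.sum_univ_castSucc, add_assoc, Fin.is_lt]

theorem deltaPoint_mem_weylChamber (k : ℕ) : deltaPoint k ∈ weylChamber k := by
  refine ⟨fun i j h => ?_, fun i => ?_⟩
  · have : i.val < j.val := h
    simp only [deltaPoint]; omega
  · have := i.is_lt
    simp only [deltaPoint]; omega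

theorem oscPosition_zero {k n : ℕ} (w : Fin n → Fin k × Bool) :
    oscPosition w 0 = deltaPoint k := by
  simp [oscPosition]

theorem ncard_oscWalksTo_zero (k : ℕ) (x : Fin k → ℤ) :
    (oscWalksTo k 0 x).ncard = if x = deltaPoint k then 1 else 0 := by
  split_ifs with h
  · rw [Set.ncard_eq_one]
    refine ⟨Fin.elim0, ?_⟩
    ext w
    simp [oscWalksTo, oscPosition_zero, deltaPoint_mem_weylChamber, h, Subsingleton.elim w Fin.elim0]
  · rw [Set.ncard_eq_zero]
    ext w
    simp [oscWalksTo, oscPosition_zero, Ne.symm h]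

theorem oscWalksTo_eq_empty {k n : ℕ} {x : Fin k → ℤ} (hx : x ∉ weylChamber k) :
    oscWalksTo k n x = ∅ := by
  ext w
  simp only [oscWalksTo, Set.mem_ofPred_eq, Set.mem_empty_iff_false, iff_false, not_and]
  rintro h rfl
  exact hx (h n le_rfl)

theorem snoc_mem_oscWalksTo {k n : ℕ} {x : Fin k → ℤ} (hx : x ∈ weylChamber k)
    (w : Fin n → Fin k × Bool) (s : Fin k × Bool) :
    (Fin.snoc w s : Fin (n + 1) → Fin k × Bool) ∈ oscWalksTo k (n + 1) x ↔
      w ∈ oscWalksTo k n (x - oscStep s) := by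
  simp only [oscWalksTo, Set.mem_ofPred_eq, oscPosition_snoc_last, eq_sub_iff_add_eq]
  refine and_congr_left fun h => ⟨fun H j hj => ?_, fun H j hj => ?_⟩
  · rw [← oscPosition_snoc_of_le w s hj]; exact H j (by omega)
  · rcases Nat.lt_or_ge n j with h' | h'
    · obtain rfl : j = n + 1 := by omega
      rw [oscPosition_snoc_last, h]; exact hx
    · rw [oscPosition_snoc_of_le w s h']; exact H j h'

theorem ncard_oscWalksTo_succ {k n : ℕ} {x : Fin k → ℤ} (hx : x ∈ weylChamber k) :
    (oscWalksTo k (n + 1) x).ncard = ∑ s, (oscWalksTo k n (x - oscStep s)).ncard := by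
  classical
  let e : (Fin k × Bool) × (Fin n → Fin k × Bool) ≃ (Fin (n + 1) → Fin k × Bool) :=
    Fin.snocEquiv fun _ => Fin k × Bool
  rw [← Set.ncard_preimage_of_injective_subset_range e.injective (by simp)]
  simp only [Set.ncard_eq_toFinset_card']
  rw [← Finset.card_sigma]
  refine Finset.card_bij' (fun p _ => ⟨p.1, p.2⟩) (fun p _ => (p.1, p.2)) ?_ ?_ ?_ ?_
  · rintro ⟨s, w⟩ h
    simpa [e, Fin.snocEquiv, snoc_mem_oscWalksTo hx] using h
  · rintro ⟨s, w⟩ h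
    simpa [e, Fin.snocEquiv, snoc_mem_oscWalksTo hx] using h
  · intros; rfl
  · intros; rfl

/-! ### Reflection principle for alternating functions -/

/-- Functions on `ℤ^k` that change sign under transpositions and sign changes of coordinates. -/
structure IsSignAlternating {k : ℕ} (f : (Fin k → ℤ) → ℚ) : Prop where
  swap : ∀ i j x, i ≠ j → f (x ∘ Equiv.swap i j) = -f x
  neg : ∀ i x, f (Function.update x i (-x i)) = -f x

theorem IsSignAlternating.eq_zero_of_eq {k : ℕ} {f : (Fin k → ℤ) → ℚ} (hf : IsSignAlternating f)
    {x : Fin k → ℤ} {i j : Fin k} (hij : i ≠ j) (h : x i = x j) : f x = 0 := by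
  have := hf.swap i j x hij
  have hx : x ∘ Equiv.swap i j = x := by
    ext l
    simp only [Function.comp_apply, Equiv.swap_apply_def]
    split_ifs <;> simp_all
  rw [hx] at this
  linarith

theorem IsSignAlternating.eq_zero_of_apply_eq_zero {k : ℕ} {f : (Fin k → ℤ) → ℚ}
    (hf : IsSignAlternating f) {x : Fin k → ℤ} {i : Fin k} (h : x i = 0) : f x = 0 := by
  have := hf.neg i x
  rw [h, neg_zero, ← h, Function.update_eq_self] at this
  linarith

/-- The steps with the sign of those in direction `i` reversed. -/
def flipStep {k : ℕ} (i : Fin k) (s : Fin k × Bool) : Fin k × Bool :=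
  (s.1, if s.1 = i then !s.2 else s.2)

theorem flipStep_involutive {k : ℕ} (i : Fin k) : Function.Involutive (flipStep i) := by
  rintro ⟨l, b⟩
  by_cases h : l = i <;> simp [flipStep, h]

/-- The signed permutations of the coordinates permute the step set. -/
theorem IsSignAlternating.sum_sub_oscStep {k : ℕ} {f : (Fin k → ℤ) → ℚ}
    (hf : IsSignAlternating f) : IsSignAlternating fun x => ∑ s, f (x - oscStep s) where
  swap i j x hij := by
    rw [← Finset.sum_neg_distrib]
    refine Fintype.sum_equiv ((Equiv.swap i j).prodCongr (Equiv.refl Bool)) _ _ fun s => ?_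
    rw [← hf.swap i j _ hij]
    congr 1
    ext l
    simp [oscStep, Pi.single_apply]
  neg i x := by
    rw [← Finset.sum_neg_distrib]
    refine Fintype.sum_equiv (flipStep_involutive i).toPerm _ _ fun s => ?_
    rw [← hf.neg i _]
    congr 1
    ext l
    rcases s with ⟨a, b⟩
    by_cases h : l = i
    · subst h
      by_cases h' : a = l
      · subst h'
        cases b <;> simp [oscStep, flipStep] <;> ring
      · simp [oscStep, flipStep, h', Ne.symm h']
    · by_cases h' : a = i
      · subst h'
        simp [oscStep, h, flipStep]
      · simp [oscStep, h, flipStep, h']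

/-- A step changes one coordinate by one, so a strict inequality between integers can at worst
become an equality: a wall cannot be jumped over. -/
theorem exists_eq_or_eq_zero_of_sub_oscStep_notMem {k : ℕ} {x : Fin k → ℤ}
    (hx : x ∈ weylChamber k) (s : Fin k × Bool) (h : x - oscStep s ∉ weylChamber k) :
    (∃ i j, i ≠ j ∧ (x - oscStep s) i = (x - oscStep s) j) ∨ ∃ i, (x - oscStep s) i = 0 := by
  have key : ∀ i, oscStep s i ≤ 1 ∧ -1 ≤ oscStep s i ∧ (s.1 ≠ i → oscStep s i = 0) := by
    intro i
    by_cases hi : s.1 = i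
    · subst hi; rcases s with ⟨a, b⟩; cases b <;> simp [oscStep]
    · simp [oscStep, Ne.symm hi]
  simp only [weylChamber, Set.mem_ofPred_eq, not_and_or, StrictAnti, not_forall, not_lt] at h
  rcases h with ⟨i, j, hij, h⟩ | ⟨i, h⟩
  · left
    refine ⟨i, j, hij.ne, ?_⟩
    have h1 := hx.1 hij
    have hi := key i
    have hj := key j
    simp only [Pi.sub_apply] at h ⊢
    by_cases hs : s.1 = i
    · have := hj.2.2 (by rw [hs]; exact hij.ne)
      omega
    · have := hi.2.2 hs
      omega
  · right
    refine ⟨i, ?_⟩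
    have h1 := hx.2 i
    have hi := key i
    simp only [Pi.sub_apply] at h ⊢
    omega

/-- The reflection principle: an alternating solution of the walk recurrence counts the walks
that stay in the chamber. -/
theorem ncard_oscWalksTo_of_isSignAlternating {k : ℕ} (ε : ℚ) (c : ℕ → (Fin k → ℤ) → ℚ)
    (h0 : ∀ x ∈ weylChamber k, c 0 x = if x = deltaPoint k then ε else 0)
    (halt : IsSignAlternating (c 0))
    (hsucc : ∀ n x, c (n + 1) x = ∑ s, c n (x - oscStep s)) (n : ℕ) {x : Fin k → ℤ}
    (hx : x ∈ weylChamber k) : c n x = ε * (oscWalksTo k n x).ncard := by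
  have hc : ∀ n, IsSignAlternating (c n) := by
    intro n
    induction n with
    | zero => exact halt
    | succ n ih =>
      rw [show c (n + 1) = fun x => ∑ s, c n (x - oscStep s) from funext (hsucc n)]
      exact ih.sum_sub_oscStep
  induction n generalizing x with
  | zero =>
    rw [h0 x hx, ncard_oscWalksTo_zero]
    split_ifs <;> simp
  | succ n ih =>
    rw [hsucc, ncard_oscWalksTo_succ hx, Nat.cast_sum, Finset.mul_sum]
    refine Finset.sum_congr rfl fun s _ => ?_
    by_cases hs : x - oscStep s ∈ weylChamber k
    · exact ih hs
    -- Both sides vanish: no chamber walk ends outside, and the predecessor lies on a wall.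
    · rw [oscWalksTo_eq_empty hs]
      rcases exists_eq_or_eq_zero_of_sub_oscStep_notMem hx s hs with ⟨i, j, hij, h⟩ | ⟨i, h⟩
      · simp [(hc n).eq_zero_of_eq hij h]
      · simp [(hc n).eq_zero_of_apply_eq_zero h]

/-! ### End points on the ray -/

theorem single_add_deltaPoint_mem_weylChamber (k : ℕ) [NeZero k] (m : ℕ) :
    Pi.single (0 : Fin k) (m : ℤ) + deltaPoint k ∈ weylChamber k := by
  have h := deltaPoint_mem_weylChamber k
  refine ⟨fun i j hij => ?_, fun i => ?_⟩
  · have := h.1 hij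
    have hj : j ≠ 0 := (lt_of_le_of_lt (Fin.zero_le i) hij).ne'
    by_cases hi : i = 0
    · subst hi; simp [hj]; omega
    · simpa [hi, hj] using this
  · have := h.2 i
    by_cases hi : i = 0
    · subst hi; simp; omega
    · simpa [hi] using this

/-- The walks ending on the first coordinate ray, sorted by their end point. -/
theorem ncard_oscWalks_eq_sum {k : ℕ} [NeZero k] {n N : ℕ}
    (hN : ∀ m ≥ N, oscWalksTo k n (Pi.single (0 : Fin k) (m : ℤ) + deltaPoint k) = ∅) :
    (oscWalks k n).ncard =
      ∑ m ∈ Finset.range N,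
        (oscWalksTo k n (Pi.single (0 : Fin k) (m : ℤ) + deltaPoint k)).ncard := by
  classical
  have hunion : oscWalks k n = ((Finset.range N).biUnion fun m : ℕ =>
      (oscWalksTo k n (Pi.single (0 : Fin k) (m : ℤ) + deltaPoint k)).toFinset : Finset _) := by
    ext w
    simp only [Finset.coe_biUnion, Set.mem_iUnion, Set.coe_toFinset, exists_prop, Finset.mem_coe,
      Finset.mem_range]
    constructor
    · rintro ⟨h, m, hm⟩
      refine ⟨m, ?_, h, hm⟩
      by_contra hlt
      have : w ∈ oscWalksTo k n (Pi.single (0 : Fin k) (m : ℤ) + deltaPoint k) := ⟨h, hm⟩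
      rw [hN m (not_lt.mp hlt)] at this
      exact this
    · rintro ⟨m, _, h, hm⟩
      exact ⟨h, m, hm⟩
  rw [hunion, Set.ncard_coe_finset, Finset.card_biUnion]
  · simp only [Set.ncard_eq_toFinset_card']
  · intro m _ m' _ hmm
    rw [Function.onFun, Finset.disjoint_left]
    intro w h1 h2
    simp only [Set.mem_toFinset] at h1 h2
    have := h1.2.symm.trans h2.2
    rw [add_left_inj, Pi.single_inj] at this
    exact hmm (by exact_mod_cast this)

/-! ### Laurent polynomials in several variables -/

open LaurentPolynomial in
/-- The Laurent polynomial `(T - T⁻¹) (T + T⁻¹)^j`. -/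
noncomputable def oddLaurent (j : ℕ) : LaurentPolynomial ℚ :=
  (T 1 - T (-1)) * (T 1 + T (-1)) ^ j

theorem coeff_oddLaurent_zero (n : ℤ) :
    (oddLaurent 0).coeff n = (if n = 1 then 1 else 0) - if n = -1 then 1 else 0 := by
  rw [oddLaurent, pow_zero, mul_one, LaurentPolynomial.T, LaurentPolynomial.T,
    AddMonoidAlgebra.coeff_sub, Finsupp.sub_apply, AddMonoidAlgebra.coeff_single,
    AddMonoidAlgebra.coeff_single, Finsupp.single_apply, Finsupp.single_apply]
  simp only [eq_comm]

theorem coeff_oddLaurent_succ (j : ℕ) (n : ℤ) :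
    (oddLaurent (j + 1)).coeff n =
      (oddLaurent j).coeff (n - 1) + (oddLaurent j).coeff (n + 1) := by
  rw [oddLaurent, pow_succ, ← mul_assoc, ← oddLaurent, mul_add]
  simp only [LaurentPolynomial.T, AddMonoidAlgebra.coeff_add, Finsupp.add_apply,
    AddMonoidAlgebra.coeff_mul_single_apply, mul_one, neg_neg]
  rfl

/-- Oddness makes the determinant of these coefficients change sign with a coordinate; the top term,
of exponent `j + 1` and coefficient 1, makes it triangular at `δ`. -/
theorem coeff_oddLaurent_neg (j : ℕ) (n : ℤ) :
    (oddLaurent j).coeff (-n) = -(oddLaurent j).coeff n := by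
  induction j generalizing n with
  | zero =>
    rw [coeff_oddLaurent_zero, coeff_oddLaurent_zero]
    simp [neg_eq_iff_eq_neg]
  | succ j ih =>
    rw [coeff_oddLaurent_succ, coeff_oddLaurent_succ, show -n - 1 = -(n + 1) by ring,
      show -n + 1 = -(n - 1) by ring, ih, ih]
    ring

theorem coeff_oddLaurent_of_lt (j : ℕ) (n : ℤ) (h : (j : ℤ) + 1 < n) :
    (oddLaurent j).coeff n = 0 := by
  induction j generalizing n with
  | zero =>
    rw [coeff_oddLaurent_zero, if_neg (by omega), if_neg (by omega), sub_zero]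
  | succ j ih =>
    rw [coeff_oddLaurent_succ, ih _ (by push_cast at h; omega), ih _ (by push_cast at h; omega),
      add_zero]

theorem coeff_oddLaurent_self (j : ℕ) : (oddLaurent j).coeff ((j : ℤ) + 1) = 1 := by
  induction j with
  | zero => rw [coeff_oddLaurent_zero]; norm_num
  | succ j ih =>
    rw [coeff_oddLaurent_succ, coeff_oddLaurent_of_lt j (_ + 1) (by push_cast; omega),
      add_zero, Nat.cast_succ, add_sub_cancel_right, ih]

/-- The ring of Laurent polynomials in `k` variables. -/
abbrev MvLaurent (k : ℕ) : Type := AddMonoidAlgebra ℚ (Fin k → ℤ)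

namespace MvLaurent

variable {k : ℕ}

/-- The Laurent polynomials in the `i`-th variable. -/
noncomputable def embed (i : Fin k) : LaurentPolynomial ℚ →+* MvLaurent k :=
  AddMonoidAlgebra.mapDomainRingHom ℚ (AddMonoidHom.single (fun _ : Fin k => ℤ) i)

/-- The `i`-th variable. -/
noncomputable def z (i : Fin k) : MvLaurent k := AddMonoidAlgebra.single (Pi.single i 1) 1

/-- The inverse of the `i`-th variable. -/
noncomputable def zInv (i : Fin k) : MvLaurent k := AddMonoidAlgebra.single (Pi.single i (-1)) 1

theorem z_mul_zInv (i : Fin k) : z i * zInv i = 1 := by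
  rw [z, zInv, AddMonoidAlgebra.single_mul_single, ← Pi.single_add]
  simp [AddMonoidAlgebra.one_def]

theorem embed_single (i : Fin k) (n : ℤ) (a : ℚ) :
    embed i (AddMonoidAlgebra.single n a) = AddMonoidAlgebra.single (Pi.single i n) a := by
  simp [embed, -LaurentPolynomial.single_eq_C_mul_T]

theorem embed_oddLaurent (i : Fin k) (j : ℕ) :
    embed i (oddLaurent j) = (z i - zInv i) * (z i + zInv i) ^ j := by
  simp only [oddLaurent, LaurentPolynomial.T, map_mul, map_sub, map_pow, map_add, embed_single,
    z, zInv]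

theorem coeff_single_mul (v x : Fin k → ℤ) (f : MvLaurent k) :
    (AddMonoidAlgebra.single v 1 * f).coeff x = f.coeff (x - v) := by
  rw [AddMonoidAlgebra.coeff_single_mul_apply, one_mul, neg_add_eq_sub]

/-- The factors involve distinct variables, so each exponent vector arises from one choice of
monomials. -/
theorem coeff_prod_embed (g : Fin k → LaurentPolynomial ℚ) (x : Fin k → ℤ) :
    (∏ i, embed i (g i)).coeff x = ∏ i, (g i).coeff (x i) := by
  classical
  have h : ∀ i, embed i (g i) =
      ∑ n ∈ (g i).coeff.support, AddMonoidAlgebra.single (Pi.single i n) ((g i).coeff n) := by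
    intro i
    conv_lhs => rw [← AddMonoidAlgebra.sum_coeff_single (g i)]
    rw [Finsupp.sum, map_sum]
    exact Finset.sum_congr rfl fun n _ => embed_single i n _
  simp_rw [h]
  rw [Finset.prod_univ_sum, AddMonoidAlgebra.coeff_sum, Finsupp.finsetSum_apply]
  simp_rw [AddMonoidAlgebra.prod_single, Finset.univ_sum_single,
    AddMonoidAlgebra.coeff_single, Finsupp.single_apply]
  rw [Finset.sum_ite_eq']
  split_ifs with hx
  · rfl
  · simp only [Fintype.mem_piFinset, not_forall, Finsupp.notMem_support_iff] at hx
    obtain ⟨i, hi⟩ := hx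
    exact (Finset.prod_eq_zero (Finset.mem_univ i) hi).symm

/-- The sum of all steps, `z₁ + z₁⁻¹ + ⋯ + z_k + z_k⁻¹`. -/
noncomputable def stepSum (k : ℕ) : MvLaurent k := ∑ i : Fin k, (z i + zInv i)

theorem stepSum_eq_sum_oscStep :
    stepSum k = ∑ s : Fin k × Bool, AddMonoidAlgebra.single (oscStep s) 1 := by
  simp [stepSum, Fintype.sum_prod_type, oscStep, z, zInv]

theorem coeff_mul_stepSum (f : MvLaurent k) (x : Fin k → ℤ) :
    (f * stepSum k).coeff x = ∑ s, f.coeff (x - oscStep s) := by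
  rw [stepSum_eq_sum_oscStep, mul_comm, Finset.sum_mul, AddMonoidAlgebra.coeff_sum,
    Finsupp.finsetSum_apply]
  exact Finset.sum_congr rfl fun s _ => coeff_single_mul _ _ _

/-! ### The Weyl denominator as a determinant -/

/-- The product of the differences of the `z_i + z_i⁻¹`. -/
noncomputable def diffProd (k : ℕ) : MvLaurent k :=
  ∏ i : Fin k, ∏ j : Fin k with j < i, ((z i + zInv i) - (z j + zInv j))

theorem det_vandermonde_eq_diffProd :
    (Matrix.vandermonde fun i : Fin k => z i + zInv i).det = diffProd k := by
  rw [Matrix.det_vandermonde, diffProd]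
  exact Finset.prod_comm' (by simp)

/-- The Weyl denominator of type `C_k`, up to sign. -/
noncomputable def weylDenom (k : ℕ) : MvLaurent k := (∏ i : Fin k, (z i - zInv i)) * diffProd k

/-- In the Leibniz expansion of the Vandermonde determinant in `z_i + z_i⁻¹`, each term absorbs the
factors `z_i - z_i⁻¹` and splits into one-variable polynomials. -/
theorem coeff_weylDenom (x : Fin k → ℤ) :
    (weylDenom k).coeff x =
      (Matrix.of fun i j : Fin k => (oddLaurent j).coeff (x i)).det := by
  have h : weylDenom k =
      ∑ σ : Equiv.Perm (Fin k), (Equiv.Perm.sign σ : ℤ) •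
        ∏ i, embed i (oddLaurent (σ i : Fin k)) := by
    rw [weylDenom, ← det_vandermonde_eq_diffProd, ← Matrix.det_transpose, Matrix.det_apply,
      Finset.mul_sum]
    refine Finset.sum_congr rfl fun σ _ => ?_
    rw [mul_smul_comm, ← Finset.prod_mul_distrib]
    simp only [embed_oddLaurent, Matrix.transpose_apply, Matrix.vandermonde_apply]
    rfl
  rw [h, ← Matrix.det_transpose, Matrix.det_apply, AddMonoidAlgebra.coeff_sum,
    Finsupp.finsetSum_apply]
  refine Finset.sum_congr rfl fun σ _ => ?_
  rw [AddMonoidAlgebra.coeff_smul_apply, coeff_prod_embed]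
  rfl

theorem isSignAlternating_coeff_weylDenom :
    IsSignAlternating fun x => (weylDenom k).coeff x where
  swap i j x hij := by
    simp only [coeff_weylDenom]
    have := Matrix.det_permute (Equiv.swap i j)
      (Matrix.of fun i j : Fin k => (oddLaurent j).coeff (x i))
    rw [Equiv.Perm.sign_swap hij] at this
    simp only [Units.val_neg, Units.val_one, Int.cast_neg, Int.cast_one, neg_mul, one_mul] at this
    exact this
  neg i x := by
    simp only [coeff_weylDenom]
    set M := Matrix.of fun i j : Fin k => (oddLaurent j).coeff (x i) with hM
    have : (Matrix.of fun a j : Fin k =>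
        (oddLaurent j).coeff (Function.update x i (-x i) a)) = M.updateRow i ((-1 : ℚ) • M i) := by
      ext a j
      by_cases h : a = i
      · subst h
        simp [hM, coeff_oddLaurent_neg]
      · simp [hM, h]
    rw [this, Matrix.det_updateRow_smul, Matrix.updateRow_eq_self]
    ring

end MvLaurent

/-! ### The Weyl denominator on the chamber -/

theorem sign_revPerm (k : ℕ) :
    Equiv.Perm.sign (Fin.revPerm : Equiv.Perm (Fin k)) = (-1) ^ (k * (k - 1) / 2) := by
  rw [Equiv.Perm.sign_eq_prod_prod_Iio]
  have : ∀ j : Fin k, (∏ i ∈ Finset.Iio j,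
      (if (Fin.revPerm i : Fin k) < Fin.revPerm j then 1 else -1 : ℤˣ)) = (-1) ^ (j : ℕ) := by
    intro j
    rw [Finset.prod_congr rfl (g := fun _ => (-1 : ℤˣ)), Finset.prod_const, Fin.card_Iio]
    intro i hi
    rw [if_neg]
    simpa using (Finset.mem_Iio.mp hi).le
  rw [Finset.prod_congr rfl fun j _ => this j, Finset.prod_pow_eq_pow_sum,
    Fin.sum_univ_eq_sum_range (fun i => i), Finset.sum_range_id]

/-- Reversing the rows gives a unitriangular matrix; the sign is that of the reversal. -/
theorem det_coeff_oddLaurent_deltaPoint (k : ℕ) :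
    (Matrix.of fun i j : Fin k => (oddLaurent j).coeff (deltaPoint k i)).det =
      (-1) ^ (k * (k - 1) / 2) := by
  set M := Matrix.of fun i j : Fin k => (oddLaurent j).coeff (deltaPoint k i) with hM
  have h1 : (M.submatrix Fin.revPerm id).det = 1 := by
    have hrev : ∀ i : Fin k, deltaPoint k (Fin.rev i) = (i : ℤ) + 1 := by
      intro i
      have := i.is_lt
      simp only [deltaPoint, Fin.val_rev]
      omega
    rw [Matrix.det_of_isUpperTriangular]
    · refine Finset.prod_eq_one fun i _ => ?_
      simp [hM, hrev, coeff_oddLaurent_self]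
    · intro i j hij
      have : j.val < i.val := hij
      simp only [hM, Matrix.submatrix_apply, Fin.revPerm_apply, id_eq, Matrix.of_apply, hrev]
      exact coeff_oddLaurent_of_lt _ _ (by omega)
  rw [Matrix.det_permute, sign_revPerm] at h1
  push_cast at h1
  have h2 : ((-1 : ℚ) ^ (k * (k - 1) / 2)) * (-1) ^ (k * (k - 1) / 2) = 1 := by
    rw [← mul_pow]; simp
  linear_combination (-1 : ℚ) ^ (k * (k - 1) / 2) * h1 - M.det * h2

/-- If `x 0 ≤ k`, then `k` strictly decreasing positive integers are squeezed into `k, …, 1`. -/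
theorem lt_apply_zero_of_ne_deltaPoint {k : ℕ} [NeZero k] {x : Fin k → ℤ}
    (hx : x ∈ weylChamber k) (hne : x ≠ deltaPoint k) : (k : ℤ) < x 0 := by
  by_contra hle
  have key : ∀ d : ℕ, ∀ i j : Fin k, j.val = i.val + d → x j + d ≤ x i := by
    intro d
    induction d with
    | zero =>
      intro i j h
      obtain rfl : j = i := Fin.ext (by simpa using h)
      simp
    | succ d ih =>
      intro i j h
      have h1 := ih i ⟨i.val + d, by omega⟩ rfl
      have h2 := hx.1 (show (⟨i.val + d, by omega⟩ : Fin k) < j from by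
        rw [Fin.lt_def]; simp; omega)
      push_cast
      omega
  apply hne
  ext i
  have hk : 0 < k := Nat.pos_of_neZero k
  have hi := i.is_lt
  have h1 := key i.val 0 i (by simp)
  have h2 := key (k - 1 - i.val) i ⟨k - 1, by omega⟩ (by simp; omega)
  have h3 := hx.2 ⟨k - 1, by omega⟩
  simp only [deltaPoint]
  omega

namespace MvLaurent

theorem coeff_weylDenom_of_mem {k : ℕ} [NeZero k] {x : Fin k → ℤ} (hx : x ∈ weylChamber k) :
    (weylDenom k).coeff x = if x = deltaPoint k then (-1) ^ (k * (k - 1) / 2) else 0 := by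
  rw [coeff_weylDenom]
  split_ifs with h
  · rw [h, det_coeff_oddLaurent_deltaPoint]
  · refine Matrix.det_eq_zero_of_row_eq_zero 0 fun j => ?_
    -- Every column has degree at most `k`, so the first row is zero.
    have := lt_apply_zero_of_ne_deltaPoint hx h
    exact coeff_oddLaurent_of_lt _ _ (by have := j.is_lt; omega)

/-- The walks in the chamber as Laurent coefficients. -/
theorem coeff_weylDenom_mul_stepSum_pow {k : ℕ} [NeZero k] (n : ℕ) {x : Fin k → ℤ}
    (hx : x ∈ weylChamber k) :
    (weylDenom k * stepSum k ^ n).coeff x =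
      (-1) ^ (k * (k - 1) / 2) * ((oscWalksTo k n x).ncard : ℚ) := by
  refine ncard_oscWalksTo_of_isSignAlternating _
    (fun n x => (weylDenom k * stepSum k ^ n).coeff x) (fun x hx => ?_) ?_ (fun n x => ?_) n hx
  · simpa using coeff_weylDenom_of_mem hx
  · simpa using isSignAlternating_coeff_weylDenom
  · rw [pow_succ, ← mul_assoc, coeff_mul_stepSum]

end MvLaurent

/-! ### The diagonal of `t^a P / (1 - t Q)` -/

theorem MvPowerSeries.optionEquivLeft_coe_rename_some {σ : Type*}
    (P : MvPolynomial σ ℚ) :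
    MvPowerSeries.optionEquivLeft σ ℚ
        ((MvPolynomial.rename some P : MvPolynomial (Option σ) ℚ) :
          MvPowerSeries (Option σ) ℚ) =
      PowerSeries.C (P : MvPowerSeries σ ℚ) := by
  induction P using MvPolynomial.induction_on with
  | C a => simp
  | add p q hp hq => simp [hp, hq]
  | mul_X p i hp => simp [hp]

theorem PowerSeries.one_sub_X_mul_C_mul_mk {R : Type*} [CommRing R] (P Q : R) (a : ℕ) :
    (1 - PowerSeries.X * PowerSeries.C Q) *
        PowerSeries.mk (fun n => if a ≤ n then P * Q ^ (n - a) else 0) =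
      PowerSeries.X ^ a * PowerSeries.C P := by
  ext n
  rw [sub_mul, one_mul, mul_assoc, map_sub, PowerSeries.coeff_mk, PowerSeries.coeff_mul_C,
    PowerSeries.coeff_X_pow]
  rcases n with _ | n
  · rw [PowerSeries.coeff_zero_X_mul, sub_zero]
    rcases Nat.eq_zero_or_pos a with rfl | ha
    · simp
    · rw [if_neg (by omega), if_neg (by omega), zero_mul]
  · rw [PowerSeries.coeff_succ_X_mul, PowerSeries.coeff_C_mul, PowerSeries.coeff_mk]
    rcases lt_trichotomy a (n + 1) with h | rfl | h
    · rw [if_pos h.le, if_pos (by omega), if_neg (by omega), Nat.sub_add_comm (by omega), pow_succ]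
      ring
    · simp
    · rw [if_neg (by omega), if_neg (by omega), if_neg (by omega)]
      ring

/-- Geometric series in `t` over the power series in the `z`'s. -/
theorem exists_expansion_one_sub {k : ℕ} (P Q : MvPolynomial (Fin k) ℚ) (a : ℕ) :
    ∃ f : MvPowerSeries (Option (Fin k)) ℚ,
      ((1 - MvPolynomial.X none * MvPolynomial.rename some Q : MvPolynomial (Option (Fin k)) ℚ) :
          MvPowerSeries (Option (Fin k)) ℚ) * f =
        ((MvPolynomial.X none ^ a * MvPolynomial.rename some P :
          MvPolynomial (Option (Fin k)) ℚ) : MvPowerSeries (Option (Fin k)) ℚ) ∧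
      diagonal f = PowerSeries.mk fun n =>
        if a ≤ n then
          MvPolynomial.coeff (Finsupp.equivFunOnFinite.symm fun _ => n) (P * Q ^ (n - a))
        else 0 := by
  let e := MvPowerSeries.optionEquivLeft (Fin k) ℚ
  let F : PowerSeries (MvPowerSeries (Fin k) ℚ) := PowerSeries.mk fun n =>
    if a ≤ n then (P : MvPowerSeries (Fin k) ℚ) * (Q : MvPowerSeries (Fin k) ℚ) ^ (n - a) else 0
  refine ⟨e.symm F, ?_, ?_⟩
  · apply e.injective
    rw [map_mul, AlgEquiv.apply_symm_apply]
    have hsub : ∀ p q : MvPolynomial (Option (Fin k)) ℚ,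
        ((p - q : MvPolynomial (Option (Fin k)) ℚ) : MvPowerSeries (Option (Fin k)) ℚ) = p - q :=
      map_sub MvPolynomial.coeToMvPowerSeries.ringHom
    simp only [hsub, MvPolynomial.coe_mul, MvPolynomial.coe_pow, MvPolynomial.coe_X,
      MvPolynomial.coe_one, map_sub, map_mul, map_one, map_pow, e,
      MvPowerSeries.optionEquivLeft_X_none, MvPowerSeries.optionEquivLeft_coe_rename_some]
    exact PowerSeries.one_sub_X_mul_C_mul_mk _ _ a
  · ext n
    have h := MvPowerSeries.coeff_coeff_optionEquivLeft (e.symm F) n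
      (Finsupp.equivFunOnFinite.symm fun _ => n)
    have hn : (Finsupp.equivFunOnFinite.symm fun _ : Fin k => n).optionElim n =
        Finsupp.equivFunOnFinite.symm fun _ : Option (Fin k) => n := by
      ext i; cases i <;> simp
    rw [hn, show MvPowerSeries.optionEquivLeft (Fin k) ℚ (e.symm F) = F from
      e.apply_symm_apply F] at h
    rw [diagonal, PowerSeries.coeff_mk, ← h, PowerSeries.coeff_mk, PowerSeries.coeff_mk]
    split_ifs
    · rw [← MvPolynomial.coe_pow, ← MvPolynomial.coe_mul, MvPolynomial.coeff_coe]
    · simp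

/-! ### The numerator and denominator as polynomials -/

open MvPolynomial in
/-- The polynomial `(z₁ ⋯ z_k) (z₁ + z₁⁻¹ + ⋯ + z_k + z_k⁻¹)`. -/
noncomputable def stepPoly (k : ℕ) : MvPolynomial (Fin k) ℚ :=
  ∑ i : Fin k, (X i ^ 2 + 1) * ∏ j ∈ Finset.univ.erase i, X j

open MvPolynomial in
/-- The numerator of `oscRational k`, without the power of `t`. -/
noncomputable def numPoly (k : ℕ) [NeZero k] : MvPolynomial (Fin k) ℚ :=
  (∏ i : Fin k with 2 ≤ i.val, X i ^ (i.val - 1))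
    * (X (0 : Fin k) + 1)
    * (∏ i : Fin k, ∏ j : Fin k with j < i, (X i - X j) * (X i * X j - 1))
    * ∏ i : Fin k with 1 ≤ i.val, (X i ^ 2 - 1)

theorem prod_mul_sum_add_eq {R ι : Type*} [CommRing R] [Fintype ι] [DecidableEq ι] (x y : ι → R)
    (h : ∀ i, x i * y i = 1) :
    (∏ i, x i) * ∑ i, (x i + y i) = ∑ i, (x i ^ 2 + 1) * ∏ j ∈ Finset.univ.erase i, x j := by
  rw [Finset.mul_sum]
  refine Finset.sum_congr rfl fun i _ => ?_
  rw [← Finset.mul_prod_erase Finset.univ x (Finset.mem_univ i)]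
  linear_combination (∏ j ∈ Finset.univ.erase i, x j) * h i

theorem oscRational_eq_div (k : ℕ) [NeZero k] :
    oscRational k =
      algebraMap _ (RatFun k)
          (MvPolynomial.X none ^ (2 * k - 1) * MvPolynomial.rename some (numPoly k)) /
        algebraMap _ (RatFun k) (1 - MvPolynomial.X none * MvPolynomial.rename some (stepPoly k)) := by
  have hz : ∀ i : Fin k, zVar i * (zVar i)⁻¹ = 1 := by
    intro i
    refine mul_inv_cancel₀ ?_
    rw [zVar, Ne, FaithfulSMul.algebraMap_eq_zero_iff]
    exact MvPolynomial.X_ne_zero _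
  rw [oscRational, mul_assoc (tVar k), prod_mul_sum_add_eq zVar _ hz]
  simp only [numPoly, stepPoly, map_mul, map_pow, map_prod, map_sum, map_add, map_sub, map_one,
    MvPolynomial.rename_X, zVar, tVar, mul_assoc]

/-! ### Clearing negative exponents -/

/-- Each index lies in `k - 1` pairs. -/
theorem prod_prod_lt_mul {R : Type*} [CommMonoid R] {k : ℕ} (x : Fin k → R) :
    ∏ i : Fin k, ∏ j : Fin k with j < i, (x i * x j) = (∏ i, x i) ^ (k - 1) := by
  have h1 : ∀ i : Fin k, ∏ j : Fin k with j < i, (x i * x j) =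
      x i ^ (i : ℕ) * ∏ j : Fin k with j < i, x j := by
    intro i
    rw [Finset.prod_mul_distrib, Finset.prod_const, Finset.filter_gt_eq_Iio, Fin.card_Iio]
  have h2 : ∏ i : Fin k, ∏ j : Fin k with j < i, x j = ∏ j : Fin k, x j ^ (k - 1 - j.val) := by
    rw [Finset.prod_comm' (t' := Finset.univ) (s' := fun j => Finset.Ioi j) (by simp)]
    refine Finset.prod_congr rfl fun j _ => ?_
    rw [Finset.prod_const, Fin.card_Ioi]
  rw [Finset.prod_congr rfl fun i _ => h1 i, Finset.prod_mul_distrib, h2,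
    ← Finset.prod_mul_distrib, ← Finset.prod_pow]
  refine Finset.prod_congr rfl fun i _ => ?_
  rw [← pow_add]
  congr 1
  have := i.is_lt
  omega

theorem prod_pow_sub_one_mul_prod {R : Type*} [CommMonoid R] {k : ℕ} (x : Fin k → R) :
    (∏ i : Fin k with 2 ≤ i.val, x i ^ (i.val - 1)) * (∏ i : Fin k with 1 ≤ i.val, x i) =
      ∏ i, x i ^ i.val := by
  rw [Finset.prod_filter, Finset.prod_filter, ← Finset.prod_mul_distrib]
  refine Finset.prod_congr rfl fun i _ => ?_
  rcases i with ⟨_ | _ | n, hi⟩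
  · simp
  · simp
  · simp [pow_succ]

namespace MvLaurent

variable {k : ℕ}

/-- Polynomials as Laurent polynomials. -/
noncomputable def ofPoly (k : ℕ) : MvPolynomial (Fin k) ℚ →ₐ[ℚ] MvLaurent k :=
  MvPolynomial.aeval z

theorem prod_z_pow (d : Fin k → ℕ) :
    ∏ i, z i ^ d i = AddMonoidAlgebra.single (fun i => (d i : ℤ)) 1 := by
  simp_rw [z, AddMonoidAlgebra.single_pow, one_pow, AddMonoidAlgebra.prod_single, Finset.prod_const_one]
  congr 1
  ext i
  simp [Finset.sum_apply, Pi.single_apply]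

theorem coeff_ofPoly (F : MvPolynomial (Fin k) ℚ) (d : Fin k →₀ ℕ) :
    (ofPoly k F).coeff (fun i => (d i : ℤ)) = F.coeff d := by
  classical
  induction F using MvPolynomial.induction_on' with
  | monomial e a =>
    rw [ofPoly, MvPolynomial.aeval_monomial, Finsupp.prod_fintype _ _ (by simp), prod_z_pow,
      ← Algebra.smul_def, AddMonoidAlgebra.coeff_smul_apply, AddMonoidAlgebra.coeff_single,
      Finsupp.single_apply, MvPolynomial.coeff_monomial]
    have : ((fun i => (e i : ℤ)) = fun i => (d i : ℤ)) ↔ e = d := by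
      simp [funext_iff, Finsupp.ext_iff]
    simp [this]
  | add p q hp hq => simp [hp, hq]

theorem ofPoly_stepPoly : ofPoly k (stepPoly k) = (∏ i, z i) * stepSum k := by
  rw [stepSum, prod_mul_sum_add_eq _ _ z_mul_zInv]
  simp [ofPoly, stepPoly]

/-- The factors of the Weyl denominator without `z₁ - z₁⁻¹`. -/
noncomputable def weylDenomTail (k : ℕ) : MvLaurent k :=
  (∏ i : Fin k with 1 ≤ i.val, (z i - zInv i)) * diffProd k

theorem weylDenom_eq_mul_tail [NeZero k] :
    weylDenom k = (z 0 - zInv 0) * weylDenomTail k := by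
  have : (Finset.univ.filter fun i : Fin k => 1 ≤ i.val) = Finset.univ.erase 0 := by
    ext i
    rw [Finset.mem_filter_univ, Finset.mem_erase, Nat.one_le_iff_ne_zero, Ne, Fin.val_eq_zero_iff]
    simp
  rw [weylDenom, weylDenomTail, this, ← mul_assoc, Finset.mul_prod_erase _ (fun i => z i - zInv i) (Finset.mem_univ _)]

theorem single_deltaPoint_eq_prod :
    (AddMonoidAlgebra.single (deltaPoint k) 1 : MvLaurent k) = ∏ i, z i ^ (k - i.val) := by
  rw [prod_z_pow]
  congr 1
  ext i
  rw [deltaPoint, Nat.cast_sub i.is_lt.le]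

/-- Since `(z_i - z_j)(z_i z_j - 1) = z_i z_j ((z_i + z_i⁻¹) - (z_j + z_j⁻¹))`, the pairs contribute
`(z₁⋯z_k)^{k-1}`. The monomial `z₃ z₄² ⋯` and the factors `z_i` extracted from `z_i² - 1` complete
`z^δ` to `(z₁⋯z_k)^k`. -/
theorem single_deltaPoint_mul_ofPoly_numPoly [NeZero k] :
    AddMonoidAlgebra.single (deltaPoint k) 1 * ofPoly k (numPoly k) =
      (∏ i, z i) ^ (2 * k - 1) * ((z 0 + 1) * weylDenomTail k) := by
  have h1 : ∏ i : Fin k, ∏ j : Fin k with j < i, ((z i - z j) * (z i * z j - 1) : MvLaurent k) =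
      (∏ i, z i) ^ (k - 1) * diffProd k := by
    rw [← prod_prod_lt_mul, diffProd, ← Finset.prod_mul_distrib]
    refine Finset.prod_congr rfl fun i _ => ?_
    rw [← Finset.prod_mul_distrib]
    refine Finset.prod_congr rfl fun j _ => ?_
    linear_combination z i * z_mul_zInv j - z j * z_mul_zInv i
  have h2 : ∏ i : Fin k with 1 ≤ i.val, (z i ^ 2 - 1 : MvLaurent k) =
      (∏ i : Fin k with 1 ≤ i.val, z i) * ∏ i : Fin k with 1 ≤ i.val, (z i - zInv i) := by
    rw [← Finset.prod_mul_distrib]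
    refine Finset.prod_congr rfl fun i _ => ?_
    linear_combination z_mul_zInv i
  have h3 : (∏ i : Fin k, (z i : MvLaurent k) ^ (k - i.val)) * (∏ i : Fin k, z i ^ i.val) =
      (∏ i, z i) ^ k := by
    rw [← Finset.prod_mul_distrib, ← Finset.prod_pow]
    refine Finset.prod_congr rfl fun i _ => ?_
    rw [← pow_add, Nat.sub_add_cancel i.is_lt.le]
  have h4 : ofPoly k (numPoly k) =
      (∏ i : Fin k with 2 ≤ i.val, z i ^ (i.val - 1)) * (z 0 + 1)
        * (∏ i : Fin k, ∏ j : Fin k with j < i, (z i - z j) * (z i * z j - 1))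
        * ∏ i : Fin k with 1 ≤ i.val, (z i ^ 2 - 1) := by
    simp [ofPoly, numPoly]
  have hk : 2 * k - 1 = k + (k - 1) := by have := Nat.pos_of_neZero k; omega
  rw [h4, h1, h2, single_deltaPoint_eq_prod, hk, pow_add, ← h3, ← prod_pow_sub_one_mul_prod,
    weylDenomTail]
  ring

theorem coeff_numPoly_mul_stepPoly_pow [NeZero k] (n : ℕ) :
    (numPoly k * stepPoly k ^ n).coeff (Finsupp.equivFunOnFinite.symm fun _ => n + (2 * k - 1)) =
      ((z 0 + 1) * (weylDenomTail k * stepSum k ^ n)).coeff (deltaPoint k) := by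
  rw [← coeff_ofPoly]
  set v : Fin k → ℤ := fun _ => ((n + (2 * k - 1) : ℕ) : ℤ) with hv
  have hZ : (∏ i : Fin k, z i) ^ (n + (2 * k - 1)) = (AddMonoidAlgebra.single v 1 : MvLaurent k) := by
    rw [← Finset.prod_pow, prod_z_pow]
  have h : AddMonoidAlgebra.single (deltaPoint k) 1 * ofPoly k (numPoly k * stepPoly k ^ n) =
      AddMonoidAlgebra.single v 1 * ((z 0 + 1) * (weylDenomTail k * stepSum k ^ n)) := by
    rw [map_mul, map_pow, ofPoly_stepPoly, ← mul_assoc, single_deltaPoint_mul_ofPoly_numPoly, ← hZ,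
      mul_pow, pow_add]
    ring
  have := congrArg (fun f : MvLaurent k => f.coeff (v + deltaPoint k)) h
  simp only [coeff_single_mul, add_sub_cancel_right, add_sub_cancel_left] at this
  exact this

/-! ### Summation along the ray -/

theorem exists_forall_coeff_single_add_eq_zero [NeZero k] (f : MvLaurent k) (x : Fin k → ℤ) :
    ∃ N : ℕ, ∀ m : ℤ, N ≤ m → f.coeff (Pi.single 0 m + x) = 0 := by
  obtain ⟨b, hb⟩ := (f.coeff.support.image fun y => y 0 - x 0).bddAbove
  refine ⟨(b + 1).toNat, fun m hm => ?_⟩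
  by_contra hne
  have : m ≤ b := hb (by
    simp only [Finset.coe_image, Set.mem_image, Finset.mem_coe, Finsupp.mem_support_iff]
    exact ⟨_, hne, by simp⟩)
  omega

/-- The sum telescopes with stride two, which leaves two boundary terms at each end; those at the
lower end form the coefficient of `(z 0 + 1) * f`. -/
theorem sum_range_coeff_sub_mul [NeZero k] (f : MvLaurent k) (x : Fin k → ℤ) (N : ℕ) :
    ∑ m ∈ Finset.range N, ((z 0 - zInv 0) * f).coeff (Pi.single 0 (m : ℤ) + x) =
      ((z 0 + 1) * f).coeff x - f.coeff (Pi.single 0 ((N : ℤ) - 1) + x) -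
        f.coeff (Pi.single 0 (N : ℤ) + x) := by
  have h : ∀ m : ℤ, ((z 0 - zInv 0) * f).coeff (Pi.single 0 m + x) =
      f.coeff (Pi.single 0 (m - 1) + x) - f.coeff (Pi.single 0 (m + 1) + x) := by
    intro m
    rw [sub_mul, AddMonoidAlgebra.coeff_sub, Finsupp.sub_apply, z, zInv, coeff_single_mul,
      coeff_single_mul, Pi.single_sub, Pi.single_add, Pi.single_neg]
    congr 2 <;> abel
  induction N with
  | zero =>
    rw [add_mul, one_mul, AddMonoidAlgebra.coeff_add, Finsupp.add_apply, z, coeff_single_mul]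
    simp [Pi.single_neg, neg_add_eq_sub]
  | succ N ih =>
    rw [Finset.sum_range_succ, ih, h]
    push_cast
    rw [add_sub_cancel_right]
    ring

theorem coeff_numPoly_mul_stepPoly_pow_eq_ncard [NeZero k] (n : ℕ) :
    (numPoly k * stepPoly k ^ n).coeff (Finsupp.equivFunOnFinite.symm fun _ => n + (2 * k - 1)) =
      (-1) ^ (k * (k - 1) / 2) * ((oscWalks k n).ncard : ℚ) := by
  set H := weylDenomTail k * stepSum k ^ n with hH
  have hD : weylDenom k * stepSum k ^ n = (z 0 - zInv 0) * H := by
    rw [weylDenom_eq_mul_tail, mul_assoc]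
  obtain ⟨N₁, h₁⟩ := exists_forall_coeff_single_add_eq_zero H (deltaPoint k)
  obtain ⟨N₂, h₂⟩ := exists_forall_coeff_single_add_eq_zero ((z 0 - zInv 0) * H) (deltaPoint k)
  have hcount := fun m : ℕ => coeff_weylDenom_mul_stepSum_pow n
    (single_add_deltaPoint_mem_weylChamber k m)
  rw [hD] at hcount
  -- From `N₂` on the walk counts vanish; `N₁ + 1` ensures that both upper boundary terms, at `N -
  -- 1` and `N`, vanish too.
  have hempty : ∀ m ≥ N₁ + N₂ + 1,
      oscWalksTo k n (Pi.single (0 : Fin k) (m : ℤ) + deltaPoint k) = ∅ := by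
    intro m hm
    have := hcount m
    rw [h₂ m (by omega)] at this
    rw [← Set.ncard_eq_zero]
    simpa using this.symm
  rw [coeff_numPoly_mul_stepPoly_pow, ← hH, ncard_oscWalks_eq_sum hempty, Nat.cast_sum,
    Finset.mul_sum, ← Finset.sum_congr rfl fun m _ => hcount m, sum_range_coeff_sub_mul,
    h₁ _ (by push_cast; omega), h₁ _ (by push_cast; omega), sub_zero, sub_zero]

end MvLaurent

theorem mainTheorem4 (k : ℕ) [NeZero k] :
    IsDiagonalOf
      ((-1) ^ (k * (k - 1) / 2) * (PowerSeries.X ^ (2 * k - 1) * oscGF k))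
      (oscRational k) := by
  obtain ⟨f, hf, hdiag⟩ := exists_expansion_one_sub (numPoly k) (stepPoly k) (2 * k - 1)
  refine ⟨f, ⟨_, _, by simp, oscRational_eq_div k, hf⟩, ?_⟩
  rw [hdiag]
  ext n
  have hC : ((-1) ^ (k * (k - 1) / 2) : PowerSeries ℚ) =
      PowerSeries.C ((-1) ^ (k * (k - 1) / 2)) := by simp
  rw [hC, PowerSeries.coeff_C_mul, PowerSeries.coeff_X_pow_mul', PowerSeries.coeff_mk]
  split_ifs with h
  · obtain ⟨m, rfl⟩ := Nat.exists_eq_add_of_le' h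
    rw [Nat.add_sub_cancel, oscGF, PowerSeries.coeff_mk,
      MvLaurent.coeff_numPoly_mul_stepPoly_pow_eq_ncard]
  · rw [mul_zero]
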